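/- Let $k$ be an algebraically closed field (of any characteristic). A twist for a Hopf algebra $A$ over $k$ is an invertible element $J\in A\otimes A$ such that $(\Delta\otimes I)(J)\,J_{12}=(I\otimes\Delta)(J)\,J_{23}$ and $(\varepsilon\otimes I)(J)=(I\otimes\varepsilon)(J)=1$. Twists $J,J'$ for $A$ are gauge equivalent if $J'=\Delta(x)J(x^{-1}\otimes x^{-1})$ for some invertible $x\in A$. For a twist $J$, $A^J$ is the Hopf algebra equal to $A$ as an algebra, with the counit of $A$ and the coproduct $\Delta^J(a)=J^{-1}\Delta(a)J$. If $A=k[\Gamma]$ is the group algebra of a finite group $\Gamma$, then $A^J$ is regarded as a triangular Hopf algebra with universal $R$-matrix $R^J=J_{21}^{-1}J$; the twist $J$ is called minimal if the left components of $R^J$ span $A$, and so do its right components (that is, $\{(I\otimes f)(R^J): f\in A^*\}=A=\{(f\otimes I)(R^J): f\in A^*\}$). An isomorphism of triangular Hopf algebras is a Hopf algebra isomorphism $f$ such that $f\otimes f$ carries one $R$-matrix to the other. **Theorem.** Let $G,G'$ be finite groups, $H\le G$ and $H'\le G'$ subgroups, and let $J$ and $J'$ be minimal twists for $k[H]$ and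 $k[H']$ respectively. Regard $J$ and $J'$ also as twists for $k[G]$ and $k[G']$ via the inclusions. Suppose that the triangular Hopf algebras $k[G]^J$ and $k[G']^{J'}$ are isomorphic. Then there exists a group isomorphism $\phi:G\to G'$ such that $\phi(H)=H'$ and $(\phi\otimes\phi)(J)$ is gauge equivalent to $J'$ as twists for $k[H']$. -/

import Mathlib

open scoped TensorProduct MonoidAlgebra

namespace HopfTwist

/-- A twist for a bialgebra `A` over `k`: an invertible element `J` of `A ⊗ A` such that
`(Δ ⊗ I)(J) J₁₂ = (I ⊗ Δ)(J) J₂₃` and `(ε ⊗ I)(J) = (I ⊗ ε)(J) = 1`. The canonical isomorphisms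
`(A ⊗ A) ⊗ A ≃ A ⊗ (A ⊗ A)`, `k ⊗ A ≃ A` and `A ⊗ k ≃ A` are written out. -/
structure Twist (k A : Type*) [CommRing k] [Ring A] [Bialgebra k A] where
  /-- the underlying invertible element of `A ⊗ A` -/
  val : (A ⊗[k] A)ˣ
  cocycle :
    Algebra.TensorProduct.assoc k k k A A A
        (Algebra.TensorProduct.map (Bialgebra.comulAlgHom k A) (AlgHom.id k A) (val : A ⊗[k] A)
          * ((val : A ⊗[k] A) ⊗ₜ[k] (1 : A)))
      = Algebra.TensorProduct.map (AlgHom.id k A) (Bialgebra.comulAlgHom k A) (val : A ⊗[k] A)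
          * ((1 : A) ⊗ₜ[k] (val : A ⊗[k] A))
  counit_left :
    Algebra.TensorProduct.lid k A
      (Algebra.TensorProduct.map (Bialgebra.counitAlgHom k A) (AlgHom.id k A)
        (val : A ⊗[k] A)) = 1
  counit_right :
    Algebra.TensorProduct.rid k k A
      (Algebra.TensorProduct.map (AlgHom.id k A) (Bialgebra.counitAlgHom k A)
        (val : A ⊗[k] A)) = 1

namespace Twist

section Bialgebra

variable {k A B : Type*} [CommRing k] [Ring A] [Bialgebra k A] [Ring B] [Bialgebra k B]

/-- Twists `J` and `J'` are gauge equivalent if `J' = Δ(x) J (x⁻¹ ⊗ x⁻¹)` for some invertible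
element `x` of `A`. -/
def GaugeEquivalent (J J' : Twist k A) : Prop :=
  ∃ x : Aˣ, (J'.val : A ⊗[k] A) =
    Bialgebra.comulAlgHom k A (x : A) * (J.val : A ⊗[k] A)
      * ((↑x⁻¹ : A) ⊗ₜ[k] (↑x⁻¹ : A))

/-- The image `(f ⊗ f)(J)` of a twist under a bialgebra homomorphism `f`. -/
def map (f : A →ₐc[k] B) (J : Twist k A) : Twist k B where
  val := Units.map
    (Algebra.TensorProduct.map (f : A →ₐ[k] B) (f : A →ₐ[k] B) : A ⊗[k] A →* B ⊗[k] B) J.val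
  cocycle := by
    have hΔ : (Bialgebra.comulAlgHom k B).comp (f : A →ₐ[k] B)
        = (Algebra.TensorProduct.map (f : A →ₐ[k] B) (f : A →ₐ[k] B)).comp
          (Bialgebra.comulAlgHom k A) := by
      ext a; simp
    have h1 : ∀ z : A ⊗[k] A,
        Algebra.TensorProduct.assoc k k k B B B
          (Algebra.TensorProduct.map (Bialgebra.comulAlgHom k B) (AlgHom.id k B)
            (Algebra.TensorProduct.map (f : A →ₐ[k] B) (f : A →ₐ[k] B) z))
        = Algebra.TensorProduct.map (f : A →ₐ[k] B)
            (Algebra.TensorProduct.map (f : A →ₐ[k] B) (f : A →ₐ[k] B))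
            (Algebra.TensorProduct.assoc k k k A A A
              (Algebra.TensorProduct.map (Bialgebra.comulAlgHom k A) (AlgHom.id k A) z)) := by
      intro z
      induction z with
      | zero => simp
      | add x y hx hy => simp only [map_add, hx, hy]
      | tmul a b =>
        have := DFunLike.congr_fun hΔ a
        simp only [AlgHom.comp_apply] at this
        simp only [Algebra.TensorProduct.map_tmul, this, AlgHom.id_apply]
        generalize Bialgebra.comulAlgHom k A a = w
        induction w with
        | zero => simp
        | add x y hx hy => simp only [map_add, TensorProduct.add_tmul, hx, hy]
        | tmul c d => simp
    have h2 : ∀ z : A ⊗[k] A,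
        Algebra.TensorProduct.map (AlgHom.id k B) (Bialgebra.comulAlgHom k B)
            (Algebra.TensorProduct.map (f : A →ₐ[k] B) (f : A →ₐ[k] B) z)
        = Algebra.TensorProduct.map (f : A →ₐ[k] B)
            (Algebra.TensorProduct.map (f : A →ₐ[k] B) (f : A →ₐ[k] B))
            (Algebra.TensorProduct.map (AlgHom.id k A) (Bialgebra.comulAlgHom k A) z) := by
      intro z
      induction z with
      | zero => simp
      | add x y hx hy => simp only [map_add, hx, hy]
      | tmul a b =>
        have := DFunLike.congr_fun hΔ b
        simp only [AlgHom.comp_apply] at this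
        simp only [Algebra.TensorProduct.map_tmul, this, AlgHom.id_apply]
    have h3 : ∀ z : A ⊗[k] A,
        Algebra.TensorProduct.assoc k k k B B B
          (Algebra.TensorProduct.map (f : A →ₐ[k] B) (f : A →ₐ[k] B) z ⊗ₜ[k] (1 : B))
        = Algebra.TensorProduct.map (f : A →ₐ[k] B)
            (Algebra.TensorProduct.map (f : A →ₐ[k] B) (f : A →ₐ[k] B))
            (Algebra.TensorProduct.assoc k k k A A A (z ⊗ₜ[k] (1 : A))) := by
      intro z
      induction z with
      | zero => simp
      | add x y hx hy => simp only [map_add, TensorProduct.add_tmul, hx, hy]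
      | tmul a b => simp
    have key := congrArg (Algebra.TensorProduct.map (f : A →ₐ[k] B)
      (Algebra.TensorProduct.map (f : A →ₐ[k] B) (f : A →ₐ[k] B))) J.cocycle
    rw [map_mul, map_mul, map_mul, ← h1, ← h2, ← h3, Algebra.TensorProduct.map_tmul,
      map_one] at key
    rw [map_mul]
    exact key
  counit_left := by
    have h : ∀ z : A ⊗[k] A,
        Algebra.TensorProduct.lid k B
          (Algebra.TensorProduct.map (Bialgebra.counitAlgHom k B) (AlgHom.id k B)
            (Algebra.TensorProduct.map (f : A →ₐ[k] B) (f : A →ₐ[k] B) z))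
        = f (Algebra.TensorProduct.lid k A
          (Algebra.TensorProduct.map (Bialgebra.counitAlgHom k A) (AlgHom.id k A) z)) := by
      intro z
      induction z with
      | zero => simp
      | add x y hx hy => simp only [map_add, hx, hy]
      | tmul a b => simp
    have := h J.val
    rw [J.counit_left, map_one] at this
    exact this
  counit_right := by
    have h : ∀ z : A ⊗[k] A,
        Algebra.TensorProduct.rid k k B
          (Algebra.TensorProduct.map (AlgHom.id k B) (Bialgebra.counitAlgHom k B)
            (Algebra.TensorProduct.map (f : A →ₐ[k] B) (f : A →ₐ[k] B) z))
        = f (Algebra.TensorProduct.rid k k A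
          (Algebra.TensorProduct.map (AlgHom.id k A) (Bialgebra.counitAlgHom k A) z)) := by
      intro z
      induction z with
      | zero => simp
      | add x y hx hy => simp only [map_add, hx, hy]
      | tmul a b => simp
    have := h J.val
    rw [J.counit_right, map_one] at this
    exact this

/-- The underlying algebra of the twisted Hopf algebra `A^J`: the algebra `A` itself (a type
synonym, so that it can carry the twisted coproduct). -/
def Twisted {k A : Type*} [CommRing k] [Ring A] [Bialgebra k A] (_J : Twist k A) : Type _ := A

instance (J : Twist k A) : Ring J.Twisted := inferInstanceAs (Ring A)

instance (J : Twist k A) : Algebra k J.Twisted := inferInstanceAs (Algebra k A)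

/-- The twisted coproduct `Δ^J(x) = J⁻¹ Δ(x) J`. -/
def comulTwisted (J : Twist k A) : A →ₐ[k] A ⊗[k] A :=
  AlgHom.ofLinearMap
    (LinearMap.mulLeft k (↑J.val⁻¹ : A ⊗[k] A) ∘ₗ LinearMap.mulRight k (J.val : A ⊗[k] A) ∘ₗ
      (Bialgebra.comulAlgHom k A).toLinearMap)
    (by simp)
    (by intro x y; simp [mul_assoc])

lemma comulTwisted_apply (J : Twist k A) (x : A) :
    J.comulTwisted x
      = (↑J.val⁻¹ : A ⊗[k] A) * Bialgebra.comulAlgHom k A x * (J.val : A ⊗[k] A) := by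
  simp [comulTwisted, mul_assoc]

lemma map_comulTwisted_id (J : Twist k A) (z : A ⊗[k] A) :
    Algebra.TensorProduct.map J.comulTwisted (AlgHom.id k A) z
      = (↑J.val⁻¹ : A ⊗[k] A) ⊗ₜ[k] (1 : A)
        * Algebra.TensorProduct.map (Bialgebra.comulAlgHom k A) (AlgHom.id k A) z
        * ((J.val : A ⊗[k] A) ⊗ₜ[k] (1 : A)) := by
  induction z with
  | zero => simp
  | add x y hx hy => simp only [map_add, hx, hy, mul_add, add_mul]
  | tmul a b =>
    simp only [Algebra.TensorProduct.map_tmul, comulTwisted_apply,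
      Algebra.TensorProduct.tmul_mul_tmul, AlgHom.id_apply, one_mul, mul_one]

lemma map_id_comulTwisted (J : Twist k A) (z : A ⊗[k] A) :
    Algebra.TensorProduct.map (AlgHom.id k A) J.comulTwisted z
      = (1 : A) ⊗ₜ[k] (↑J.val⁻¹ : A ⊗[k] A)
        * Algebra.TensorProduct.map (AlgHom.id k A) (Bialgebra.comulAlgHom k A) z
        * ((1 : A) ⊗ₜ[k] (J.val : A ⊗[k] A)) := by
  induction z with
  | zero => simp
  | add x y hx hy => simp only [map_add, hx, hy, mul_add, add_mul]
  | tmul a b =>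
    simp only [Algebra.TensorProduct.map_tmul, comulTwisted_apply,
      Algebra.TensorProduct.tmul_mul_tmul, AlgHom.id_apply, one_mul, mul_one]

lemma cocycle_inv (J : Twist k A) :
    Algebra.TensorProduct.assoc k k k A A A
        (((↑J.val⁻¹ : A ⊗[k] A) ⊗ₜ[k] (1 : A)) *
          Algebra.TensorProduct.map (Bialgebra.comulAlgHom k A) (AlgHom.id k A)
            (↑J.val⁻¹ : A ⊗[k] A))
      = ((1 : A) ⊗ₜ[k] (↑J.val⁻¹ : A ⊗[k] A)) *
        Algebra.TensorProduct.map (AlgHom.id k A) (Bialgebra.comulAlgHom k A)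
          (↑J.val⁻¹ : A ⊗[k] A) := by
  refine left_inv_eq_right_inv (a := Algebra.TensorProduct.assoc k k k A A A
        (Algebra.TensorProduct.map (Bialgebra.comulAlgHom k A) (AlgHom.id k A) (J.val : A ⊗[k] A)
          * ((J.val : A ⊗[k] A) ⊗ₜ[k] (1 : A)))) ?_ ?_
  · rw [← map_mul, mul_assoc, ← mul_assoc (Algebra.TensorProduct.map _ _ _), ← map_mul]
    simp [← Algebra.TensorProduct.one_def]
  · rw [J.cocycle, mul_assoc, ← mul_assoc ((1 : A) ⊗ₜ[k] _)]
    simp only [Algebra.TensorProduct.tmul_mul_tmul, one_mul, Units.mul_inv]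
    rw [← Algebra.TensorProduct.one_def, one_mul, ← map_mul]
    simp

lemma counit_left' (J : Twist k A) :
    Algebra.TensorProduct.map (Bialgebra.counitAlgHom k A) (AlgHom.id k A)
      (J.val : A ⊗[k] A) = 1 :=
  (Algebra.TensorProduct.lid k A).injective (by rw [J.counit_left, map_one])

lemma counit_right' (J : Twist k A) :
    Algebra.TensorProduct.map (AlgHom.id k A) (Bialgebra.counitAlgHom k A)
      (J.val : A ⊗[k] A) = 1 :=
  (Algebra.TensorProduct.rid k k A).injective (by rw [J.counit_right, map_one])

lemma counit_left_inv (J : Twist k A) :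
    Algebra.TensorProduct.map (Bialgebra.counitAlgHom k A) (AlgHom.id k A)
      (↑J.val⁻¹ : A ⊗[k] A) = 1 := by
  have h := congrArg (Algebra.TensorProduct.map (Bialgebra.counitAlgHom k A) (AlgHom.id k A))
    J.val.mul_inv
  rwa [map_mul, J.counit_left', one_mul, map_one] at h

lemma counit_right_inv (J : Twist k A) :
    Algebra.TensorProduct.map (AlgHom.id k A) (Bialgebra.counitAlgHom k A)
      (↑J.val⁻¹ : A ⊗[k] A) = 1 := by
  have h := congrArg (Algebra.TensorProduct.map (AlgHom.id k A) (Bialgebra.counitAlgHom k A))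
    J.val.mul_inv
  rwa [map_mul, J.counit_right', one_mul, map_one] at h

lemma coassoc_comulTwisted (J : Twist k A) (x : A) :
    Algebra.TensorProduct.assoc k k k A A A
        (Algebra.TensorProduct.map J.comulTwisted (AlgHom.id k A) (J.comulTwisted x))
      = Algebra.TensorProduct.map (AlgHom.id k A) J.comulTwisted (J.comulTwisted x) := by
  rw [map_comulTwisted_id, map_id_comulTwisted, comulTwisted_apply]
  simp only [map_mul]
  have h1 := J.cocycle
  have h2 := J.cocycle_inv
  have h3 : Algebra.TensorProduct.assoc k k k A A A
      (Algebra.TensorProduct.map (Bialgebra.comulAlgHom k A) (AlgHom.id k A)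
        (Bialgebra.comulAlgHom k A x))
      = Algebra.TensorProduct.map (AlgHom.id k A) (Bialgebra.comulAlgHom k A)
        (Bialgebra.comulAlgHom k A x) := Coalgebra.coassoc_apply x
  rw [map_mul] at h1 h2
  simp only [← mul_assoc]
  rw [h2, h3]
  rw [mul_assoc, h1]
  simp only [← mul_assoc]

lemma counit_left_comulTwisted (J : Twist k A) (x : A) :
    Algebra.TensorProduct.map (Bialgebra.counitAlgHom k A) (AlgHom.id k A) (J.comulTwisted x)
      = (1 : k) ⊗ₜ[k] x := by
  rw [comulTwisted_apply, map_mul, map_mul, J.counit_left', J.counit_left_inv, one_mul, mul_one]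
  exact Coalgebra.rTensor_counit_comul x

lemma counit_right_comulTwisted (J : Twist k A) (x : A) :
    Algebra.TensorProduct.map (AlgHom.id k A) (Bialgebra.counitAlgHom k A) (J.comulTwisted x)
      = x ⊗ₜ[k] (1 : k) := by
  rw [comulTwisted_apply, map_mul, map_mul, J.counit_right', J.counit_right_inv, one_mul, mul_one]
  exact Coalgebra.lTensor_counit_comul x

/-- The coalgebra `(A^J, Δ^J, ε)`. -/
instance instCoalgebraTwisted (J : Twist k A) : Coalgebra k J.Twisted where
  comul := J.comulTwisted.toLinearMap
  counit := (Bialgebra.counitAlgHom k A).toLinearMap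
  coassoc := LinearMap.ext (coassoc_comulTwisted J)
  rTensor_counit_comp_comul := LinearMap.ext (counit_left_comulTwisted J)
  lTensor_counit_comp_comul := LinearMap.ext (counit_right_comulTwisted J)

/-- The bialgebra `A^J`: the algebra `A` with coproduct `Δ^J` and counit `ε`. -/
instance instBialgebraTwisted (J : Twist k A) : Bialgebra k J.Twisted :=
  Bialgebra.mk' k J.Twisted (map_one (Bialgebra.counitAlgHom k A))
    (fun {a b} => map_mul (Bialgebra.counitAlgHom k A) a b)
    (map_one J.comulTwisted) (fun {a b} => map_mul J.comulTwisted a b)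

/-- The universal R-matrix `R^J = J₂₁⁻¹ J` of `A^J`, where `A` is cocommutative and carries the
trivial triangular structure `1 ⊗ 1` (as group algebras do). -/
def rMatrix (J : Twist k A) : J.Twisted ⊗[k] J.Twisted :=
  (Algebra.TensorProduct.comm k A A (↑J.val⁻¹ : A ⊗[k] A) * (J.val : A ⊗[k] A) : A ⊗[k] A)

end Bialgebra

section Hopf

variable {k A : Type*} [CommRing k] [Ring A] [HopfAlgebra k A]

/-- The linear map `u ⊗ v ↦ S(u) q v`. -/
def leftAct (q : A) : A ⊗[k] A →ₗ[k] A :=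
  LinearMap.mul' k A ∘ₗ
    TensorProduct.map (LinearMap.mulRight k q ∘ₗ HopfAlgebra.antipode k) LinearMap.id

/-- The linear map `u ⊗ v ↦ u q S(v)`. -/
def rightAct (q : A) : A ⊗[k] A →ₗ[k] A :=
  LinearMap.mul' k A ∘ₗ
    TensorProduct.map (LinearMap.mulRight k q) (HopfAlgebra.antipode k)

@[simp] lemma leftAct_tmul (q u v : A) :
    leftAct (k := k) q (u ⊗ₜ[k] v) = HopfAlgebra.antipode k u * q * v := by
  simp [leftAct]

@[simp] lemma rightAct_tmul (q u v : A) :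
    rightAct (k := k) q (u ⊗ₜ[k] v) = u * q * HopfAlgebra.antipode k v := by
  simp [rightAct]

lemma leftAct_mul (q : A) (z w : A ⊗[k] A) :
    leftAct q (z * w) = leftAct (leftAct q z) w := by
  induction w with
  | zero => simp
  | add x y hx hy => simp only [mul_add, map_add, hx, hy]
  | tmul a b =>
    induction z with
    | zero => simp
    | add x y hx hy =>
      rw [add_mul, map_add, hx, hy, map_add]
      simp only [leftAct_tmul, mul_add, add_mul]
    | tmul c d => simp [HopfAlgebra.antipode_mul_antidistrib, mul_assoc]

lemma rightAct_mul (q : A) (z w : A ⊗[k] A) :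
    rightAct q (z * w) = rightAct (rightAct q w) z := by
  induction z with
  | zero => simp
  | add x y hx hy => simp only [add_mul, map_add, hx, hy]
  | tmul a b =>
    induction w with
    | zero => simp
    | add x y hx hy =>
      rw [mul_add, map_add, hx, hy, map_add]
      simp only [rightAct_tmul, mul_add, add_mul]
    | tmul c d => simp [HopfAlgebra.antipode_mul_antidistrib, mul_assoc]

lemma leftAct_one_comul (a : A) :
    leftAct (k := k) 1 (Bialgebra.comulAlgHom k A a)
      = algebraMap k A (Coalgebra.counit (R := k) a) := by
  rw [← HopfAlgebra.mul_antipode_rTensor_comul_apply (R := k) a]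
  simp only [Bialgebra.comulAlgHom_apply]
  generalize Coalgebra.comul (R := k) a = z
  induction z with
  | zero => simp
  | add x y hx hy => simp only [map_add, hx, hy]
  | tmul c d => simp

lemma rightAct_one_comul (a : A) :
    rightAct (k := k) 1 (Bialgebra.comulAlgHom k A a)
      = algebraMap k A (Coalgebra.counit (R := k) a) := by
  rw [← HopfAlgebra.mul_antipode_lTensor_comul_apply (R := k) a]
  simp only [Bialgebra.comulAlgHom_apply]
  generalize Coalgebra.comul (R := k) a = z
  induction z with
  | zero => simp
  | add x y hx hy => simp only [map_add, hx, hy]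
  | tmul c d => simp

lemma leftAct_one_comul_mul (b : A) (w : A ⊗[k] A) :
    leftAct 1 (Bialgebra.comulAlgHom k A b * w)
      = (Coalgebra.counit (R := k) b) • leftAct 1 w := by
  rw [leftAct_mul, leftAct_one_comul]
  induction w with
  | zero => simp
  | add x y hx hy => simp only [map_add, hx, hy, smul_add]
  | tmul c d =>
    simp [Algebra.algebraMap_eq_smul_one]

lemma rightAct_one_mul_comul (b : A) (w : A ⊗[k] A) :
    rightAct 1 (w * Bialgebra.comulAlgHom k A b)
      = (Coalgebra.counit (R := k) b) • rightAct 1 w := by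
  rw [rightAct_mul, rightAct_one_comul]
  induction w with
  | zero => simp
  | add x y hx hy => simp only [map_add, hx, hy, smul_add]
  | tmul c d =>
    simp [Algebra.algebraMap_eq_smul_one]

/-- The element `Q = S(J⁽¹⁾) J⁽²⁾`. -/
def antipodeElt (J : Twist k A) : A := leftAct (k := k) 1 (J.val : A ⊗[k] A)

/-- The inverse `J⁻⁽¹⁾ S(J⁻⁽²⁾)` of `Q`. -/
def antipodeEltInv (J : Twist k A) : A := rightAct (k := k) 1 (↑J.val⁻¹ : A ⊗[k] A)

lemma leftAct_antipodeElt (J : Twist k A) :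
    leftAct J.antipodeElt (↑J.val⁻¹ : A ⊗[k] A) = 1 := by
  rw [antipodeElt, ← leftAct_mul, Units.mul_inv]
  simp [Algebra.TensorProduct.one_def]

lemma rightAct_antipodeEltInv (J : Twist k A) :
    rightAct J.antipodeEltInv (J.val : A ⊗[k] A) = 1 := by
  rw [antipodeEltInv, ← rightAct_mul, Units.mul_inv]
  simp [Algebra.TensorProduct.one_def]

/-- The linear map `a ⊗ (b ⊗ c) ↦ S(a) b S(c)`. -/
def sandwich : A ⊗[k] (A ⊗[k] A) →ₗ[k] A :=
  LinearMap.mul' k A ∘ₗ TensorProduct.map (HopfAlgebra.antipode k) (rightAct 1)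

/-- The linear map `a ⊗ (b ⊗ c) ↦ a S(b) c`. -/
def sandwich' : A ⊗[k] (A ⊗[k] A) →ₗ[k] A :=
  LinearMap.mul' k A ∘ₗ TensorProduct.map LinearMap.id (leftAct 1)

@[simp] lemma sandwich_tmul (a : A) (z : A ⊗[k] A) :
    sandwich (a ⊗ₜ[k] z) = HopfAlgebra.antipode k a * rightAct 1 z := by
  simp [sandwich]

@[simp] lemma sandwich'_tmul (a : A) (z : A ⊗[k] A) :
    sandwich' (a ⊗ₜ[k] z) = a * leftAct 1 z := by
  simp [sandwich']

lemma sandwich_mul (z w : A ⊗[k] A) :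
    sandwich (Algebra.TensorProduct.assoc k k k A A A (z ⊗ₜ[k] (1 : A)) * ((1 : A) ⊗ₜ[k] w))
      = leftAct 1 z * rightAct 1 w := by
  induction z with
  | zero => simp
  | add x y hx hy => simp only [TensorProduct.add_tmul, map_add, add_mul, hx, hy]
  | tmul u v =>
    induction w with
    | zero => simp
    | add x y hx hy => simp only [TensorProduct.tmul_add, map_add, mul_add, hx, hy]
    | tmul a b => simp [mul_assoc]

lemma sandwich'_mul (z w : A ⊗[k] A) :
    sandwich' (((1 : A) ⊗ₜ[k] w) * Algebra.TensorProduct.assoc k k k A A A (z ⊗ₜ[k] (1 : A)))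
      = rightAct 1 z * leftAct 1 w := by
  induction z with
  | zero => simp
  | add x y hx hy => simp only [TensorProduct.add_tmul, map_add, mul_add, add_mul, hx, hy]
  | tmul u v =>
    induction w with
    | zero => simp
    | add x y hx hy => simp only [TensorProduct.tmul_add, map_add, mul_add, add_mul, hx, hy]
    | tmul a b => simp [HopfAlgebra.antipode_mul_antidistrib, mul_assoc]

lemma sandwich_comul_aux (y : A ⊗[k] A) (v a b : A) :
    sandwich (Algebra.TensorProduct.assoc k k k A A A (y ⊗ₜ[k] v)
        * (a ⊗ₜ[k] Bialgebra.comulAlgHom k A b))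
      = Coalgebra.counit (R := k) b •
        (HopfAlgebra.antipode k a * leftAct 1 y * HopfAlgebra.antipode k v) := by
  induction y with
  | zero => simp
  | add x y hx hy =>
    simp only [TensorProduct.add_tmul, map_add, add_mul, mul_add, smul_add, hx, hy]
  | tmul c d =>
    rw [Algebra.TensorProduct.assoc_tmul, Algebra.TensorProduct.tmul_mul_tmul, sandwich_tmul,
      rightAct_one_mul_comul]
    simp [HopfAlgebra.antipode_mul_antidistrib, mul_assoc]

lemma sandwich'_comul_aux (y : A ⊗[k] A) (v a b : A) :
    sandwich' ((a ⊗ₜ[k] Bialgebra.comulAlgHom k A b)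
        * Algebra.TensorProduct.assoc k k k A A A (y ⊗ₜ[k] v))
      = Coalgebra.counit (R := k) b • (a * rightAct 1 y * v) := by
  induction y with
  | zero => simp
  | add x y hx hy =>
    simp only [TensorProduct.add_tmul, map_add, add_mul, mul_add, smul_add, hx, hy]
  | tmul c d =>
    rw [Algebra.TensorProduct.assoc_tmul, Algebra.TensorProduct.tmul_mul_tmul, sandwich'_tmul,
      leftAct_one_comul_mul]
    simp [mul_assoc]

lemma sandwich_comul (z w : A ⊗[k] A) :
    sandwich (Algebra.TensorProduct.assoc k k k A A A
        (Algebra.TensorProduct.map (Bialgebra.comulAlgHom k A) (AlgHom.id k A) z)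
        * Algebra.TensorProduct.map (AlgHom.id k A) (Bialgebra.comulAlgHom k A) w)
      = HopfAlgebra.antipode k (Algebra.TensorProduct.rid k k A
          (Algebra.TensorProduct.map (AlgHom.id k A) (Bialgebra.counitAlgHom k A) w))
        * HopfAlgebra.antipode k (Algebra.TensorProduct.lid k A
          (Algebra.TensorProduct.map (Bialgebra.counitAlgHom k A) (AlgHom.id k A) z)) := by
  induction z with
  | zero => simp
  | add x y hx hy => simp only [map_add, add_mul, mul_add, hx, hy]
  | tmul u v =>
    induction w with
    | zero => simp
    | add x y hx hy => simp only [map_add, add_mul, mul_add, hx, hy]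
    | tmul a b =>
      rw [Algebra.TensorProduct.map_tmul, Algebra.TensorProduct.map_tmul, AlgHom.id_apply,
        AlgHom.id_apply, sandwich_comul_aux, leftAct_one_comul]
      simp [Algebra.algebraMap_eq_smul_one, smul_comm (Coalgebra.counit (R := k) b)]

lemma sandwich'_comul (z w : A ⊗[k] A) :
    sandwich' (Algebra.TensorProduct.map (AlgHom.id k A) (Bialgebra.comulAlgHom k A) w
        * Algebra.TensorProduct.assoc k k k A A A
        (Algebra.TensorProduct.map (Bialgebra.comulAlgHom k A) (AlgHom.id k A) z))
      = Algebra.TensorProduct.rid k k A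
          (Algebra.TensorProduct.map (AlgHom.id k A) (Bialgebra.counitAlgHom k A) w)
        * Algebra.TensorProduct.lid k A
          (Algebra.TensorProduct.map (Bialgebra.counitAlgHom k A) (AlgHom.id k A) z) := by
  induction z with
  | zero => simp
  | add x y hx hy => simp only [map_add, mul_add, hx, hy]
  | tmul u v =>
    induction w with
    | zero => simp
    | add x y hx hy => simp only [map_add, add_mul, hx, hy]
    | tmul a b =>
      rw [Algebra.TensorProduct.map_tmul, Algebra.TensorProduct.map_tmul, AlgHom.id_apply,
        AlgHom.id_apply, sandwich'_comul_aux, rightAct_one_comul]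
      simp [Algebra.algebraMap_eq_smul_one, smul_comm (Coalgebra.counit (R := k) b)]

lemma antipodeElt_mul_inv (J : Twist k A) : J.antipodeElt * J.antipodeEltInv = 1 := by
  rw [antipodeElt, antipodeEltInv, ← sandwich_mul]
  have key : Algebra.TensorProduct.assoc k k k A A A ((J.val : A ⊗[k] A) ⊗ₜ[k] (1 : A))
        * ((1 : A) ⊗ₜ[k] (↑J.val⁻¹ : A ⊗[k] A))
      = Algebra.TensorProduct.assoc k k k A A A
        (Algebra.TensorProduct.map (Bialgebra.comulAlgHom k A) (AlgHom.id k A)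
          (↑J.val⁻¹ : A ⊗[k] A))
        * Algebra.TensorProduct.map (AlgHom.id k A) (Bialgebra.comulAlgHom k A)
          (J.val : A ⊗[k] A) := by
    have h := congrArg (fun t => Algebra.TensorProduct.assoc k k k A A A
        (Algebra.TensorProduct.map (Bialgebra.comulAlgHom k A) (AlgHom.id k A)
          (↑J.val⁻¹ : A ⊗[k] A)) * t * ((1 : A) ⊗ₜ[k] (↑J.val⁻¹ : A ⊗[k] A))) J.cocycle
    rw [← map_mul, ← mul_assoc (Algebra.TensorProduct.map _ _ _), ← map_mul, Units.inv_mul,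
      map_one, one_mul] at h
    rw [h, mul_assoc, mul_assoc, Algebra.TensorProduct.tmul_mul_tmul, Units.mul_inv, one_mul,
      ← Algebra.TensorProduct.one_def, mul_one]
  rw [key, sandwich_comul, J.counit_right]
  rw [counit_left_inv]
  simp

lemma antipodeElt_inv_mul (J : Twist k A) : J.antipodeEltInv * J.antipodeElt = 1 := by
  rw [antipodeElt, antipodeEltInv, ← sandwich'_mul]
  have key : ((1 : A) ⊗ₜ[k] (J.val : A ⊗[k] A))
        * Algebra.TensorProduct.assoc k k k A A A ((↑J.val⁻¹ : A ⊗[k] A) ⊗ₜ[k] (1 : A))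
      = Algebra.TensorProduct.map (AlgHom.id k A) (Bialgebra.comulAlgHom k A)
          (↑J.val⁻¹ : A ⊗[k] A)
        * Algebra.TensorProduct.assoc k k k A A A
        (Algebra.TensorProduct.map (Bialgebra.comulAlgHom k A) (AlgHom.id k A)
          (J.val : A ⊗[k] A)) := by
    have h := congrArg (fun t => Algebra.TensorProduct.map (AlgHom.id k A)
        (Bialgebra.comulAlgHom k A) (↑J.val⁻¹ : A ⊗[k] A) * t
        * Algebra.TensorProduct.assoc k k k A A A ((↑J.val⁻¹ : A ⊗[k] A) ⊗ₜ[k] (1 : A)))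
        J.cocycle
    rw [← mul_assoc (Algebra.TensorProduct.map _ _ _) (Algebra.TensorProduct.map _ _ _), ← map_mul,
      Units.inv_mul, map_one, one_mul] at h
    rw [← h, mul_assoc, ← map_mul, mul_assoc, Algebra.TensorProduct.tmul_mul_tmul,
      Units.mul_inv, one_mul, ← Algebra.TensorProduct.one_def, mul_one]
  rw [key, sandwich'_comul, J.counit_left]
  rw [counit_right_inv]
  simp

/-- The antipode `S^J(a) = Q⁻¹ S(a) Q` of `A^J`. -/
def antipodeTwisted (J : Twist k A) : A →ₗ[k] A :=
  LinearMap.mulLeft k J.antipodeEltInv ∘ₗ LinearMap.mulRight k J.antipodeElt ∘ₗ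
    HopfAlgebra.antipode k

lemma mul_antipodeTwisted_rTensor (J : Twist k A) (z : A ⊗[k] A) :
    LinearMap.mul' k A (J.antipodeTwisted.rTensor A z)
      = J.antipodeEltInv * leftAct J.antipodeElt z := by
  induction z with
  | zero => simp
  | add x y hx hy => simp only [map_add, mul_add, hx, hy]
  | tmul a b => simp [antipodeTwisted, mul_assoc]

lemma mul_antipodeTwisted_lTensor (J : Twist k A) (z : A ⊗[k] A) :
    LinearMap.mul' k A (J.antipodeTwisted.lTensor A z)
      = rightAct J.antipodeEltInv z * J.antipodeElt := by
  induction z with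
  | zero => simp
  | add x y hx hy => simp only [map_add, add_mul, hx, hy]
  | tmul a b => simp [antipodeTwisted, mul_assoc]

lemma antipodeTwisted_left (J : Twist k A) (a : A) :
    LinearMap.mul' k A (J.antipodeTwisted.rTensor A (J.comulTwisted a))
      = algebraMap k A (Coalgebra.counit (R := k) a) := by
  rw [mul_antipodeTwisted_rTensor, comulTwisted_apply, mul_assoc, leftAct_mul,
    leftAct_antipodeElt, leftAct_one_comul_mul, ← antipodeElt, mul_smul_comm,
    antipodeElt_inv_mul, Algebra.algebraMap_eq_smul_one]

lemma antipodeTwisted_right (J : Twist k A) (a : A) :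
    LinearMap.mul' k A (J.antipodeTwisted.lTensor A (J.comulTwisted a))
      = algebraMap k A (Coalgebra.counit (R := k) a) := by
  rw [mul_antipodeTwisted_lTensor, comulTwisted_apply, rightAct_mul,
    rightAct_antipodeEltInv, rightAct_one_mul_comul, ← antipodeEltInv, smul_mul_assoc,
    antipodeElt_inv_mul, Algebra.algebraMap_eq_smul_one]

/-- The Hopf algebra `A^J`, for a twist `J` of a Hopf algebra `A`: the bialgebra structure above
together with the antipode `S^J`. -/
instance instHopfAlgebraTwisted (J : Twist k A) : HopfAlgebra k J.Twisted where
  antipode := J.antipodeTwisted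
  mul_antipode_rTensor_comul := LinearMap.ext (antipodeTwisted_left J)
  mul_antipode_lTensor_comul := LinearMap.ext (antipodeTwisted_right J)

end Hopf
/-- A twist `J` is minimal if the left components of `R^J`, and likewise its right components,
span the whole algebra. The span of the left (right) components of a tensor `R` is the set of all
its contractions `(I ⊗ f)(R)` (resp. `(f ⊗ I)(R)`) with linear functionals `f`. -/
def IsMinimal {k A : Type*} [CommRing k] [Ring A] [Bialgebra k A] (J : Twist k A) : Prop :=
  Submodule.span k (Set.range fun f : Module.Dual k J.Twisted =>
      TensorProduct.rid k J.Twisted (f.lTensor J.Twisted J.rMatrix)) = ⊤ ∧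
  Submodule.span k (Set.range fun f : Module.Dual k J.Twisted =>
      TensorProduct.lid k J.Twisted (f.rTensor J.Twisted J.rMatrix)) = ⊤

end Twist

/-- The (quasi)triangular Hopf algebras `(A, R)` and `(B, R')` are isomorphic: there is an
isomorphism of Hopf algebras `f : A → B` with `(f ⊗ f)(R) = R'`. (A bialgebra isomorphism between
Hopf algebras automatically intertwines the antipodes.) -/
def TriangularIsomorphic (k : Type*) {A B : Type*} [CommRing k] [Ring A] [HopfAlgebra k A]
    [Ring B] [HopfAlgebra k B] (R : A ⊗[k] A) (R' : B ⊗[k] B) : Prop :=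
  ∃ f : A ≃ₐc[k] B, TensorProduct.map (f : A →ₗ[k] B) (f : A →ₗ[k] B) R = R'

/-- A twist for `k[H]`, for a subgroup `H` of `G`, regarded as a twist for `k[G]`. -/
noncomputable def Twist.ofSubgroup {k G : Type*} [Field k] [Group G] {H : Subgroup G}
    (J : Twist k k[H]) : Twist k k[G] :=
  J.map (MonoidAlgebra.mapDomainBialgHom k H.subtype)

end HopfTwist

/-! Let `f` be the given triangular isomorphism. Transporting `J'` back along `f` gives a twist F =
J · (f⊗f)⁻¹(J')⁻¹ of k[G], and compatibility of `f` with the R-matrices says exactly that F is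
symmetric (`Twist.exists_symm_twist`). A symmetric twist is a coboundary
(`Twist.exists_comul_mul_eq_of_comm_eq`): it deforms the product on the dual into a commutative
algebra, which has a character because k is algebraically closed; that character is evaluation at
some x, and multiplicativity reads Δ(x)F = x⊗x. Correcting `f` by conjugation by x gives a bialgebra
isomorphism φ, hence a group isomorphism ψ, with J' = Δ(y)(φ⊗φ)(J)(y⁻¹⊗y⁻¹) for y = f(x)
(`TriangularIsomorphic.exists_gauge`).

The remaining problem is that y lies in k[G'] rather than k[H']. By minimality, k[H] and k[H'] are
the spans of the components of the two R-matrices, so `f` carries one onto the other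
(`range_le_range_of_map_eq`). The gauge relation then puts Δ(y) in (k[H']⊗k[H'])(y⊗y), and
contracting one leg with a coordinate functional produces a group element a = zy with z in k[H']
(`exists_of_eq_mul`). Replacing ψ by Ad(a)∘ψ sends H onto H', and the gauge element becomes z⁻¹,
which lies in k[H']. -/

namespace HopfTwist

open TensorProduct

/-! ### Characters, and functionals on tensor products -/

/-- A nonzero finite-dimensional commutative algebra over an algebraically closed field has a
character. -/
theorem nonempty_algHom_of_finite (k D : Type*) [Field k] [IsAlgClosed k] [CommRing D]
    [Algebra k D] [Module.Finite k D] [Nontrivial D] : Nonempty (D →ₐ[k] k) := by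
  obtain ⟨M, hM⟩ := Ideal.exists_maximal D
  -- The residue field is a finite extension of an algebraically closed field, hence equal to k.
  have hb : Function.Bijective (algebraMap k (D ⧸ M)) :=
    IsAlgClosed.algebraMap_bijective_of_isIntegral
  exact ⟨((AlgEquiv.ofBijective (Algebra.ofId k (D ⧸ M)) hb).symm : D ⧸ M →ₐ[k] k).comp
    (Ideal.Quotient.mkₐ k M)⟩

/-- Functionals of the form `f ⊗ g` separate the points of a tensor product of finite-dimensional
vector spaces. -/
theorem eq_of_dualDistrib_eq {k V W : Type*} [Field k] [AddCommGroup V] [Module k V]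
    [AddCommGroup W] [Module k W] [Module.Finite k V] [Module.Finite k W] {s t : V ⊗[k] W}
    (h : ∀ (f : Module.Dual k V) (g : Module.Dual k W),
      dualDistrib k V W (f ⊗ₜ g) s = dualDistrib k V W (f ⊗ₜ g) t) : s = t := by
  refine sub_eq_zero.1 ((Module.forall_dual_apply_eq_zero_iff k (s - t)).1 fun φ => ?_)
  rw [map_sub, sub_eq_zero]
  obtain ⟨w, rfl⟩ := (dualDistribEquiv k V W).surjective φ
  change dualDistrib k V W w s = dualDistrib k V W w t
  induction w with
  | zero => simp
  | add x y hx hy => simp only [map_add, LinearMap.add_apply, hx, hy]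
  | tmul f g => exact h f g

namespace Twist

/-! ### The dual algebra deformed by a twist -/

section Dual

variable {k A : Type*} [Field k] [Ring A] [Bialgebra k A]

/-- The dual space of `A` with the multiplication `(f g)(a) = (f ⊗ g)(Δ(a) F)` given by a
twist `F`. -/
def TwistedDual (_F : Twist k A) : Type _ := Module.Dual k A

namespace TwistedDual

variable (F : Twist k A)

instance : AddCommGroup F.TwistedDual := inferInstanceAs (AddCommGroup (Module.Dual k A))

instance : Module k F.TwistedDual := inferInstanceAs (Module k (Module.Dual k A))

instance [Module.Finite k A] : Module.Finite k F.TwistedDual :=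
  inferInstanceAs (Module.Finite k (Module.Dual k A))

/-- The product of two functionals determined by the twist `F`. -/
def mulFun (f g : Module.Dual k A) : Module.Dual k A :=
  dualDistrib k A A (f ⊗ₜ g) ∘ₗ LinearMap.mulRight k (F.val : A ⊗[k] A) ∘ₗ
    (Bialgebra.comulAlgHom k A).toLinearMap

lemma mulFun_apply (f g : Module.Dual k A) (a : A) :
    mulFun F f g a
      = dualDistrib k A A (f ⊗ₜ g) (Bialgebra.comulAlgHom k A a * (F.val : A ⊗[k] A)) := rfl

/-- Together with `dualDistrib_mulFun_right`, this turns each bracketing of a triple product into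
the single functional f⊗(g⊗h), so that associativity becomes an identity in A⊗(A⊗A). -/
lemma dualDistrib_mulFun_left (f g h : Module.Dual k A) (z : A ⊗[k] A) :
    dualDistrib k A A (mulFun F f g ⊗ₜ h) z
      = dualDistrib k A (A ⊗[k] A) (f ⊗ₜ dualDistrib k A A (g ⊗ₜ h))
        (Algebra.TensorProduct.assoc k k k A A A
          (Algebra.TensorProduct.map (Bialgebra.comulAlgHom k A) (AlgHom.id k A) z
            * ((F.val : A ⊗[k] A) ⊗ₜ[k] (1 : A)))) := by
  induction z with
  | zero => simp
  | add x y hx hy => simp only [map_add, add_mul, hx, hy]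
  | tmul a b =>
    rw [Algebra.TensorProduct.map_tmul, Algebra.TensorProduct.tmul_mul_tmul, dualDistrib_apply,
      mulFun_apply]
    generalize Bialgebra.comulAlgHom k A a * (F.val : A ⊗[k] A) = w
    induction w with
    | zero => simp
    | add x y hx hy => simp only [map_add, add_tmul, add_mul, hx, hy]
    | tmul c d => simp [mul_assoc]

lemma dualDistrib_mulFun_right (f g h : Module.Dual k A) (z : A ⊗[k] A) :
    dualDistrib k A A (f ⊗ₜ mulFun F g h) z
      = dualDistrib k A (A ⊗[k] A) (f ⊗ₜ dualDistrib k A A (g ⊗ₜ h))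
        (Algebra.TensorProduct.map (AlgHom.id k A) (Bialgebra.comulAlgHom k A) z
            * ((1 : A) ⊗ₜ[k] (F.val : A ⊗[k] A))) := by
  induction z with
  | zero => simp
  | add x y hx hy => simp only [map_add, add_mul, hx, hy]
  | tmul a b =>
    rw [Algebra.TensorProduct.map_tmul, Algebra.TensorProduct.tmul_mul_tmul, dualDistrib_apply,
      mulFun_apply, dualDistrib_apply]
    simp

/-- Associativity is the dual form of the twist equation combined with coassociativity. -/
lemma mulFun_assoc (f g h : Module.Dual k A) :
    mulFun F (mulFun F f g) h = mulFun F f (mulFun F g h) := by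
  ext a
  rw [mulFun_apply, mulFun_apply, dualDistrib_mulFun_left, dualDistrib_mulFun_right]
  have h3 : Algebra.TensorProduct.assoc k k k A A A
      (Algebra.TensorProduct.map (Bialgebra.comulAlgHom k A) (AlgHom.id k A)
        (Bialgebra.comulAlgHom k A a))
      = Algebra.TensorProduct.map (AlgHom.id k A) (Bialgebra.comulAlgHom k A)
        (Bialgebra.comulAlgHom k A a) := Coalgebra.coassoc_apply a
  rw [map_mul (Algebra.TensorProduct.map _ _), mul_assoc, map_mul, F.cocycle, h3,
    map_mul (Algebra.TensorProduct.map _ _), mul_assoc]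

/-- The normalization (ε⊗I)(F) = 1 is what keeps ε a unit after the deformation. -/
lemma counit_mulFun (f : Module.Dual k A) : mulFun F Coalgebra.counit f = f := by
  have key : ∀ z : A ⊗[k] A, dualDistrib k A A (Coalgebra.counit ⊗ₜ f) z
      = f (Algebra.TensorProduct.lid k A
        (Algebra.TensorProduct.map (Bialgebra.counitAlgHom k A) (AlgHom.id k A) z)) := by
    intro z
    induction z with
    | zero => simp
    | add x y hx hy => simp only [map_add, hx, hy]
    | tmul a b => simp
  have h : ∀ a : A, Algebra.TensorProduct.map (Bialgebra.counitAlgHom k A) (AlgHom.id k A)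
      (Bialgebra.comulAlgHom k A a) = 1 ⊗ₜ a := Coalgebra.rTensor_counit_comul
  ext a
  rw [mulFun_apply, key, map_mul, F.counit_left', mul_one, h]
  simp

lemma mulFun_counit (f : Module.Dual k A) : mulFun F f Coalgebra.counit = f := by
  have key : ∀ z : A ⊗[k] A, dualDistrib k A A (f ⊗ₜ Coalgebra.counit) z
      = f (Algebra.TensorProduct.rid k k A
        (Algebra.TensorProduct.map (AlgHom.id k A) (Bialgebra.counitAlgHom k A) z)) := by
    intro z
    induction z with
    | zero => simp
    | add x y hx hy => simp only [map_add, hx, hy]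
    | tmul a b => simp [mul_comm]
  have h : ∀ a : A, Algebra.TensorProduct.map (AlgHom.id k A) (Bialgebra.counitAlgHom k A)
      (Bialgebra.comulAlgHom k A a) = a ⊗ₜ 1 := Coalgebra.lTensor_counit_comul
  ext a
  rw [mulFun_apply, key, map_mul, F.counit_right', mul_one, h]
  simp

/-- Swapping f and g amounts to flipping Δ(a)F, and both factors are invariant under the flip. -/
lemma mulFun_comm [Coalgebra.IsCocomm k A]
    (hF : Algebra.TensorProduct.comm k A A (F.val : A ⊗[k] A) = F.val)
    (f g : Module.Dual k A) : mulFun F f g = mulFun F g f := by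
  have key : ∀ z : A ⊗[k] A, dualDistrib k A A (f ⊗ₜ g) z
      = dualDistrib k A A (g ⊗ₜ f) (Algebra.TensorProduct.comm k A A z) := by
    intro z
    induction z with
    | zero => simp
    | add x y hx hy => simp only [map_add, hx, hy]
    | tmul a b => simp [mul_comm]
  have h : ∀ a : A, Algebra.TensorProduct.comm k A A (Bialgebra.comulAlgHom k A a)
      = Bialgebra.comulAlgHom k A a := Coalgebra.comm_comul k
  ext a
  rw [mulFun_apply, mulFun_apply, key, map_mul, hF, h]

lemma mulFun_add (f g h : Module.Dual k A) : mulFun F f (g + h) = mulFun F f g + mulFun F f h := by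
  ext a
  simp only [mulFun_apply, tmul_add, map_add, LinearMap.add_apply]

lemma add_mulFun (f g h : Module.Dual k A) : mulFun F (f + g) h = mulFun F f h + mulFun F g h := by
  ext a
  simp only [mulFun_apply, add_tmul, map_add, LinearMap.add_apply]

lemma smul_mulFun (r : k) (f g : Module.Dual k A) : mulFun F (r • f) g = r • mulFun F f g := by
  ext a
  simp only [mulFun_apply, ← smul_tmul', map_smul, LinearMap.smul_apply]

lemma mulFun_smul (r : k) (f g : Module.Dual k A) : mulFun F f (r • g) = r • mulFun F f g := by
  ext a
  simp only [mulFun_apply, tmul_smul, map_smul, LinearMap.smul_apply]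

lemma zero_mulFun (f : Module.Dual k A) : mulFun F 0 f = 0 := by
  simpa using smul_mulFun F 0 0 f

lemma mulFun_zero (f : Module.Dual k A) : mulFun F f 0 = 0 := by
  simpa using mulFun_smul F 0 f 0

instance : Ring F.TwistedDual where
  __ := (inferInstance : AddCommGroup F.TwistedDual)
  mul := mulFun F
  one := (Coalgebra.counit : Module.Dual k A)
  left_distrib := mulFun_add F
  right_distrib := add_mulFun F
  zero_mul := zero_mulFun F
  mul_zero := mulFun_zero F
  mul_assoc := mulFun_assoc F
  one_mul := counit_mulFun F
  mul_one := mulFun_counit F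

instance : Algebra k F.TwistedDual := Algebra.ofModule (smul_mulFun F) (mulFun_smul F)

instance : Nontrivial F.TwistedDual :=
  ⟨⟨0, 1, fun h => zero_ne_one (α := k) <|
    (LinearMap.congr_fun (h : (0 : Module.Dual k A) = Coalgebra.counit) 1).trans
      Bialgebra.counit_one⟩⟩

end TwistedDual

end Dual

/-! ### Symmetric twists are coboundaries -/

/-- A symmetric twist `F` of a finite-dimensional cocommutative Hopf algebra over an algebraically
closed field is a coboundary. -/
theorem exists_comul_mul_eq_of_comm_eq {k A : Type*} [Field k] [IsAlgClosed k] [Ring A]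
    [HopfAlgebra k A] [Module.Finite k A] [Coalgebra.IsCocomm k A] (F : Twist k A)
    (hF : Algebra.TensorProduct.comm k A A (F.val : A ⊗[k] A) = F.val) :
    ∃ x : Aˣ, Bialgebra.comulAlgHom k A (x : A) * (F.val : A ⊗[k] A) = (x : A) ⊗ₜ[k] (x : A) := by
  let _ : CommRing F.TwistedDual :=
    { (inferInstance : Ring F.TwistedDual) with mul_comm := TwistedDual.mulFun_comm F hF }
  obtain ⟨χ⟩ := nonempty_algHom_of_finite k F.TwistedDual
  -- By finite dimension the character, a functional on the dual, is evaluation at an element x.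
  obtain ⟨x, hx⟩ := (Module.evalEquiv k A).surjective (χ.toLinearMap : F.TwistedDual →ₗ[k] k)
  have hχ : ∀ f : Module.Dual k A, χ (f : F.TwistedDual) = f x := fun f =>
    (LinearMap.congr_fun hx f).symm
  have hΔ : Bialgebra.comulAlgHom k A x * (F.val : A ⊗[k] A) = x ⊗ₜ[k] x := by
    refine eq_of_dualDistrib_eq fun f g => ?_
    rw [← TwistedDual.mulFun_apply, dualDistrib_apply, ← hχ, ← hχ, ← hχ]
    exact map_mul χ (show F.TwistedDual from f) (show F.TwistedDual from g)
  have hε : Coalgebra.counit (R := k) x = 1 := by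
    rw [← hχ]
    exact map_one χ
  -- Apply u⊗v ↦ S(u)v to Δ(x)F = x⊗x: the left side collapses to ε(x)Q = Q, where Q = S(F⁽¹⁾)F⁽²⁾
  -- is invertible. Thus x has a left inverse, which is two-sided in finite dimension.
  have hS : HopfAlgebra.antipode k x * x = F.antipodeElt := by
    have h := leftAct_one_comul_mul (k := k) x (F.val : A ⊗[k] A)
    rw [hΔ, leftAct_tmul, mul_one, hε, one_smul] at h
    exact h
  have hl : (F.antipodeEltInv * HopfAlgebra.antipode k x) * x = 1 := by
    rw [mul_assoc, hS, antipodeElt_inv_mul]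
  have : IsArtinianRing A := IsArtinianRing.of_finite k A
  exact ⟨⟨x, _, mul_eq_one_comm.1 hl, hl⟩, hΔ⟩

/-! ### Composing and inverting twists; the symmetric twist of an isomorphism -/

section Bialgebra

variable {k A B : Type*} [CommRing k] [Ring A] [Bialgebra k A] [Ring B] [Bialgebra k B]

/-- If `J` is a twist for `A` and `K` is a twist for `A^J`, then `J K` is a twist for `A`. -/
def comp (J : Twist k A) (K : Twist k J.Twisted) : Twist k A where
  val := J.val * (show (A ⊗[k] A)ˣ from K.val)
  cocycle := by
    set L : (A ⊗[k] A)ˣ := K.val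
    have hL : Algebra.TensorProduct.assoc k k k A A A
        (Algebra.TensorProduct.map J.comulTwisted (AlgHom.id k A) (L : A ⊗[k] A)
          * ((L : A ⊗[k] A) ⊗ₜ[k] (1 : A)))
      = Algebra.TensorProduct.map (AlgHom.id k A) J.comulTwisted (L : A ⊗[k] A)
          * ((1 : A) ⊗ₜ[k] (L : A ⊗[k] A)) := K.cocycle
    -- Moving J₁₂ to the left converts Δ into the twisted coproduct, so the equation for JK splits
    -- into those for J and K; `h2` does the same for J₂₃.
    have h1 : ∀ z : A ⊗[k] A, Algebra.TensorProduct.map (Bialgebra.comulAlgHom k A)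
        (AlgHom.id k A) z * ((J.val : A ⊗[k] A) ⊗ₜ[k] (1 : A))
        = ((J.val : A ⊗[k] A) ⊗ₜ[k] (1 : A)) *
          Algebra.TensorProduct.map J.comulTwisted (AlgHom.id k A) z := by
      intro z
      rw [map_comulTwisted_id, ← mul_assoc, ← mul_assoc, Algebra.TensorProduct.tmul_mul_tmul,
        Units.mul_inv, one_mul, ← Algebra.TensorProduct.one_def, one_mul]
    have h2 : ∀ z : A ⊗[k] A, Algebra.TensorProduct.map (AlgHom.id k A)
        (Bialgebra.comulAlgHom k A) z * ((1 : A) ⊗ₜ[k] (J.val : A ⊗[k] A))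
        = ((1 : A) ⊗ₜ[k] (J.val : A ⊗[k] A)) *
          Algebra.TensorProduct.map (AlgHom.id k A) J.comulTwisted z := by
      intro z
      rw [map_id_comulTwisted, ← mul_assoc, ← mul_assoc, Algebra.TensorProduct.tmul_mul_tmul,
        Units.mul_inv, one_mul, ← Algebra.TensorProduct.one_def, one_mul]
    have e1 : ((J.val : A ⊗[k] A) * (L : A ⊗[k] A)) ⊗ₜ[k] (1 : A)
        = ((J.val : A ⊗[k] A) ⊗ₜ[k] (1 : A)) * ((L : A ⊗[k] A) ⊗ₜ[k] (1 : A)) := by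
      rw [Algebra.TensorProduct.tmul_mul_tmul, one_mul]
    have e2 : (1 : A) ⊗ₜ[k] ((J.val : A ⊗[k] A) * (L : A ⊗[k] A))
        = ((1 : A) ⊗ₜ[k] (J.val : A ⊗[k] A)) * ((1 : A) ⊗ₜ[k] (L : A ⊗[k] A)) := by
      rw [Algebra.TensorProduct.tmul_mul_tmul, one_mul]
    change Algebra.TensorProduct.assoc k k k A A A
        (Algebra.TensorProduct.map (Bialgebra.comulAlgHom k A) (AlgHom.id k A)
            ((J.val : A ⊗[k] A) * (L : A ⊗[k] A))
          * (((J.val : A ⊗[k] A) * (L : A ⊗[k] A)) ⊗ₜ[k] (1 : A)))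
      = Algebra.TensorProduct.map (AlgHom.id k A) (Bialgebra.comulAlgHom k A)
            ((J.val : A ⊗[k] A) * (L : A ⊗[k] A))
          * ((1 : A) ⊗ₜ[k] ((J.val : A ⊗[k] A) * (L : A ⊗[k] A)))
    rw [e1, e2, map_mul (Algebra.TensorProduct.map _ _), map_mul (Algebra.TensorProduct.map _ _),
      mul_assoc, ← mul_assoc _ _ ((L : A ⊗[k] A) ⊗ₜ[k] (1 : A)), h1,
      mul_assoc _ _ ((L : A ⊗[k] A) ⊗ₜ[k] (1 : A)), ← mul_assoc, map_mul, J.cocycle, hL,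
      mul_assoc, mul_assoc, ← mul_assoc _ _ ((1 : A) ⊗ₜ[k] (L : A ⊗[k] A)), ← h2, mul_assoc]
  counit_left := by
    set L : (A ⊗[k] A)ˣ := K.val
    change Algebra.TensorProduct.lid k A (Algebra.TensorProduct.map (Bialgebra.counitAlgHom k A)
      (AlgHom.id k A) ((J.val : A ⊗[k] A) * (L : A ⊗[k] A))) = 1
    rw [map_mul, map_mul, J.counit_left, one_mul]
    exact K.counit_left
  counit_right := by
    set L : (A ⊗[k] A)ˣ := K.val
    change Algebra.TensorProduct.rid k k A (Algebra.TensorProduct.map (AlgHom.id k A)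
      (Bialgebra.counitAlgHom k A) ((J.val : A ⊗[k] A) * (L : A ⊗[k] A))) = 1
    rw [map_mul, map_mul, J.counit_right, one_mul]
    exact K.counit_right

/-- The inverse of a twist `J` is a twist for `A^J`. -/
def inv (J : Twist k A) : Twist k J.Twisted where
  val := show (A ⊗[k] A)ˣ from J.val⁻¹
  cocycle := by
    change Algebra.TensorProduct.assoc k k k A A A
        (Algebra.TensorProduct.map J.comulTwisted (AlgHom.id k A) (↑J.val⁻¹ : A ⊗[k] A)
          * ((↑J.val⁻¹ : A ⊗[k] A) ⊗ₜ[k] (1 : A)))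
      = Algebra.TensorProduct.map (AlgHom.id k A) J.comulTwisted (↑J.val⁻¹ : A ⊗[k] A)
          * ((1 : A) ⊗ₜ[k] (↑J.val⁻¹ : A ⊗[k] A))
    rw [map_comulTwisted_id, map_id_comulTwisted, mul_assoc, mul_assoc _ _ ((1 : A) ⊗ₜ[k] _),
      Algebra.TensorProduct.tmul_mul_tmul, Algebra.TensorProduct.tmul_mul_tmul, Units.mul_inv,
      one_mul, ← Algebra.TensorProduct.one_def, ← Algebra.TensorProduct.one_def, mul_one, mul_one]
    exact J.cocycle_inv
  counit_left := congrArg (Algebra.TensorProduct.lid k A) J.counit_left_inv |>.trans (map_one _)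
  counit_right := congrArg (Algebra.TensorProduct.rid k k A) J.counit_right_inv |>.trans (map_one _)

/-- An isomorphism `A^J ≃ B^{J'}` that is compatible with the R-matrices comes from a symmetric
twist of `A`, namely `J (f ⊗ f)⁻¹(J')⁻¹`. -/
theorem exists_symm_twist (J : Twist k A) (J' : Twist k B)
    (f : A ≃ₐ[k] B)
    (hΔ : ∀ a, Algebra.TensorProduct.map (f : A →ₐ[k] B) (f : A →ₐ[k] B) (J.comulTwisted a)
      = J'.comulTwisted (f a))
    (hε : ∀ a, Coalgebra.counit (R := k) (f a) = Coalgebra.counit (R := k) a)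
    (hR : Algebra.TensorProduct.map (f : A →ₐ[k] B) (f : A →ₐ[k] B)
        (Algebra.TensorProduct.comm k A A (↑J.val⁻¹ : A ⊗[k] A) * (J.val : A ⊗[k] A))
      = Algebra.TensorProduct.comm k B B (↑J'.val⁻¹ : B ⊗[k] B) * (J'.val : B ⊗[k] B)) :
    ∃ F : Twist k A, Algebra.TensorProduct.comm k A A (F.val : A ⊗[k] A) = F.val ∧
      Algebra.TensorProduct.map (f : A →ₐ[k] B) (f : A →ₐ[k] B) (F.val : A ⊗[k] A)
        * (J'.val : B ⊗[k] B)
        = Algebra.TensorProduct.map (f : A →ₐ[k] B) (f : A →ₐ[k] B) (J.val : A ⊗[k] A) := by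
  set ff := Algebra.TensorProduct.map (f : A →ₐ[k] B) (f : A →ₐ[k] B)
  set gg := Algebra.TensorProduct.map (f.symm : B →ₐ[k] A) (f.symm : B →ₐ[k] A)
  have hfg : ∀ z, ff (gg z) = z := by
    intro z
    induction z with
    | zero => simp
    | add x y hx hy => simp only [map_add, hx, hy]
    | tmul a b => simp [ff, gg]
  have hgf : ∀ z, gg (ff z) = z := by
    intro z
    induction z with
    | zero => simp
    | add x y hx hy => simp only [map_add, hx, hy]
    | tmul a b => simp [ff, gg]
  have hcomm : ∀ z, ff (Algebra.TensorProduct.comm k A A z)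
      = Algebra.TensorProduct.comm k B B (ff z) := by
    intro z
    induction z with
    | zero => simp
    | add x y hx hy => simp only [map_add, hx, hy]
    | tmul a b => simp [ff]
  have hε' : ∀ b, Coalgebra.counit (R := k) (f.symm b) = Coalgebra.counit (R := k) b := fun b => by
    rw [← hε, f.apply_symm_apply]
  have hΔ' : ∀ b, gg (J'.comulTwisted b) = J.comulTwisted (f.symm b) := fun b => by
    rw [← hgf (J.comulTwisted (f.symm b)), hΔ, f.apply_symm_apply]
  -- The inverse of `f` is a bialgebra map between the twisted algebras, so it carries the twist
  -- J'⁻¹ of B^J' to a twist of A^J, which can be composed with J.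
  let g : J'.Twisted →ₐc[k] J.Twisted := BialgHom.ofAlgHom (R := k)
    (show J'.Twisted →ₐ[k] J.Twisted from (f.symm : B →ₐ[k] A))
    (AlgHom.ext hε') (AlgHom.ext hΔ')
  refine ⟨J.comp (J'.inv.map g), ?_, ?_⟩
  · change Algebra.TensorProduct.comm k A A ((J.val : A ⊗[k] A) * gg (↑J'.val⁻¹ : B ⊗[k] B))
      = (J.val : A ⊗[k] A) * gg (↑J'.val⁻¹ : B ⊗[k] B)
    apply Function.LeftInverse.injective hgf
    rw [hcomm, map_mul ff, hfg, map_mul]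
    rw [map_mul ff, hcomm] at hR
    have h1 : Algebra.TensorProduct.comm k B B (ff (J.val : A ⊗[k] A))
        * Algebra.TensorProduct.comm k B B (ff (↑J.val⁻¹ : A ⊗[k] A)) = 1 := by
      rw [← map_mul, ← map_mul ff, Units.mul_inv, map_one, map_one]
    -- Multiplying the R-matrix identity by J₂₁ on the left and J'⁻¹ on the right (with J moved to B
    -- by f⊗f) turns it into symmetry of J·J'⁻¹.
    have h2 := congrArg (fun t => Algebra.TensorProduct.comm k B B (ff (J.val : A ⊗[k] A)) * t
      * (↑J'.val⁻¹ : B ⊗[k] B)) hR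
    simp only [← mul_assoc, h1, one_mul] at h2
    rw [h2, mul_assoc, Units.mul_inv, mul_one]
  · change ff ((J.val : A ⊗[k] A) * gg (↑J'.val⁻¹ : B ⊗[k] B)) * (J'.val : B ⊗[k] B) = _
    rw [map_mul, hfg, mul_assoc, Units.inv_mul, mul_one]

end Bialgebra

end Twist
-- Contractions, component spans and group elements
lemma rid_lTensor_map {k U W : Type*} [CommRing k] [AddCommGroup U] [Module k U] [AddCommGroup W]
    [Module k W] (w : U →ₗ[k] W) (l : Module.Dual k W) (z : U ⊗[k] U) :
    TensorProduct.rid k W (l.lTensor W (TensorProduct.map w w z))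
      = w (TensorProduct.rid k U ((l ∘ₗ w).lTensor U z)) := by
  induction z with
  | zero => simp
  | add x y hx hy => simp only [map_add, hx, hy]
  | tmul a b => simp

/-- If `(u ⊗ u)(R) = (v ⊗ v)(R')` with `u` injective and the left components of `R` span `V`, then
the range of `u` is contained in the range of `v`. -/
theorem range_le_range_of_map_eq {k V V' W : Type*} [Field k] [AddCommGroup V] [Module k V]
    [AddCommGroup V'] [Module k V'] [AddCommGroup W] [Module k W] (u : V →ₗ[k] W)
    (v : V' →ₗ[k] W) (hu : Function.Injective u) (R : V ⊗[k] V) (R' : V' ⊗[k] V')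
    (h : TensorProduct.map u u R = TensorProduct.map v v R')
    (hR : Submodule.span k (Set.range fun f : Module.Dual k V =>
      TensorProduct.rid k V (f.lTensor V R)) = ⊤) :
    LinearMap.range u ≤ LinearMap.range v := by
  rw [LinearMap.range_eq_map, ← hR, Submodule.map_span, Submodule.span_le]
  rintro _ ⟨_, ⟨f, rfl⟩, rfl⟩
  -- A left inverse of `u` extends each functional on V to W, so contractions of R can be computed
  -- in W, where R and R' have the same image.
  obtain ⟨l, hl⟩ := LinearMap.exists_leftInverse_of_injective u (LinearMap.ker_eq_bot.2 hu)
  have h1 := rid_lTensor_map u (f ∘ₗ l) R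
  rw [LinearMap.comp_assoc, hl, LinearMap.comp_id, h, rid_lTensor_map] at h1
  exact ⟨_, h1⟩

/-- Contracting the second factor of `Δ(y)` with the coordinate functional at `g` gives
`y(g) g`. -/
theorem rid_lTensor_comul {k G : Type*} [Field k] [Group G] (y : k[G]) (g : G) :
    TensorProduct.rid k k[G] (((Finsupp.lapply g : (G →₀ k) →ₗ[k] k) ∘ₗ
      (MonoidAlgebra.coeffLinearEquiv k).toLinearMap).lTensor k[G]
        (Bialgebra.comulAlgHom k k[G] y)) = y.coeff g • MonoidAlgebra.of k G g := by
  classical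
  induction y using MonoidAlgebra.induction_linear with
  | zero => simp
  | add x y hx hy => simp only [map_add, hx, hy, MonoidAlgebra.coeff_add, Finsupp.add_apply, add_smul]
  | single h r =>
    simp [Finsupp.single_apply]
    split_ifs <;> simp_all

/-- If `Δ(y) = (q ⊗ q)(T) (y ⊗ y)` with `y ≠ 0`, then the left coset `range(q) y` contains an
element of the group. -/
theorem exists_of_eq_mul {k G Q : Type*} [Field k] [Group G] [Ring Q] [Algebra k Q]
    (q : Q →ₐ[k] k[G]) (y : k[G]) (hy : y ≠ 0) (T : Q ⊗[k] Q)
    (h : Bialgebra.comulAlgHom k k[G] y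
      = Algebra.TensorProduct.map q q T * (y ⊗ₜ[k] y)) :
    ∃ (g : G) (z : Q), MonoidAlgebra.of k G g = q z * y := by
  obtain ⟨g, hg⟩ : ∃ g, y.coeff g ≠ 0 := by
    by_contra! hc
    exact hy (MonoidAlgebra.ext (Finsupp.ext hc))
  -- Contracting the second leg of an element of (q(Q)⊗q(Q))(y⊗y) leaves an element of q(Q)y; on
  -- Δ(y), the coordinate functional at g leaves y(g)g.
  have key : ∀ (l : Module.Dual k k[G]) (T : Q ⊗[k] Q), ∃ z : Q,
      TensorProduct.rid k k[G] (l.lTensor k[G]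
        (Algebra.TensorProduct.map q q T * (y ⊗ₜ[k] y))) = q z * y := by
    intro l T
    induction T with
    | zero => exact ⟨0, by simp⟩
    | add a b ha hb =>
      obtain ⟨z, hz⟩ := ha
      obtain ⟨w, hw⟩ := hb
      exact ⟨z + w, by simp only [map_add, add_mul, hz, hw]⟩
    | tmul a b => exact ⟨l (q b * y) • a, by simp⟩
  obtain ⟨z, hz⟩ := key _ T
  rw [← h, rid_lTensor_comul y g] at hz
  refine ⟨g, (y.coeff g)⁻¹ • z, ?_⟩
  rw [map_smul, smul_mul_assoc, ← hz, smul_smul, inv_mul_cancel₀ hg, one_smul]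

/-- A group element in the image of `k[H] → k[G]` comes from `H`. -/
theorem mem_range_of_mapDomain_eq_of {k G H : Type*} [Field k] [Group G] [Group H] (j : H →* G)
    (w : k[H]) (g : G) (h : MonoidAlgebra.mapDomainBialgHom k j w = MonoidAlgebra.of k G g) :
    g ∈ j.range := by
  classical
  by_contra hg
  have : ∀ w : k[H], (MonoidAlgebra.mapDomainBialgHom k j w).coeff g = 0 := by
    intro w
    induction w using MonoidAlgebra.induction_linear with
    | zero => simp
    | add x y hx hy => simp only [map_add, hx, hy, MonoidAlgebra.coeff_add, Finsupp.add_apply, add_zero]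
    | single m r =>
      rw [MonoidAlgebra.mapDomainBialgHom_single, MonoidAlgebra.coeff_single, Finsupp.single_apply,
        if_neg]
      rintro rfl
      exact hg ⟨m, rfl⟩
  have h1 := this w
  rw [h] at h1
  simp at h1

/-! ### From a triangular isomorphism to a bialgebra isomorphism and a gauge -/

/-- An isomorphism `(A^J, R^J) ≃ (B^K, R^K)` in terms of the algebras `A` and `B`. -/
theorem TriangularIsomorphic.exists_algEquiv {k A B : Type*} [CommRing k] [Ring A]
    [HopfAlgebra k A] [Ring B] [HopfAlgebra k B] {J : Twist k A} {K : Twist k B}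
    (h : TriangularIsomorphic k J.rMatrix K.rMatrix) :
    ∃ f : A ≃ₐ[k] B,
      (∀ a, Algebra.TensorProduct.map (f : A →ₐ[k] B) (f : A →ₐ[k] B) (J.comulTwisted a)
        = K.comulTwisted (f a)) ∧
      (∀ a, Coalgebra.counit (R := k) (f a) = Coalgebra.counit (R := k) a) ∧
      Algebra.TensorProduct.map (f : A →ₐ[k] B) (f : A →ₐ[k] B)
          (Algebra.TensorProduct.comm k A A (↑J.val⁻¹ : A ⊗[k] A) * (J.val : A ⊗[k] A))
        = Algebra.TensorProduct.comm k B B (↑K.val⁻¹ : B ⊗[k] B) * (K.val : B ⊗[k] B) := by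
  obtain ⟨F, hF⟩ := h
  exact ⟨(F : J.Twisted ≃ₐ[k] K.Twisted), CoalgHomClass.map_comp_comul_apply F,
    CoalgHomClass.counit_comp_apply F, hF⟩

/-- If `(A^J, R^J)` and `(B^K, R^K)` are isomorphic triangular Hopf algebras, with `A`, `B`
finite-dimensional and cocommutative, then there is an isomorphism `A ≃ B` that carries `J` to
a twist gauge equivalent to `K`. -/
theorem TriangularIsomorphic.exists_gauge {k A B : Type*} [Field k] [IsAlgClosed k] [Ring A]
    [HopfAlgebra k A] [Module.Finite k A] [Coalgebra.IsCocomm k A] [Ring B] [HopfAlgebra k B]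
    {J : Twist k A} {K : Twist k B} (h : TriangularIsomorphic k J.rMatrix K.rMatrix) :
    ∃ (φ : A ≃ₐc[k] B) (f : A ≃ₐ[k] B) (y : Bˣ),
      (∀ a, f a = y * φ a * (↑y⁻¹ : B)) ∧
      Algebra.TensorProduct.map (f : A →ₐ[k] B) (f : A →ₐ[k] B)
          (Algebra.TensorProduct.comm k A A (↑J.val⁻¹ : A ⊗[k] A) * (J.val : A ⊗[k] A))
        = Algebra.TensorProduct.comm k B B (↑K.val⁻¹ : B ⊗[k] B) * (K.val : B ⊗[k] B) ∧
      (K.val : B ⊗[k] B) = Bialgebra.comulAlgHom k B (y : B)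
        * Algebra.TensorProduct.map (φ : A →ₐ[k] B) (φ : A →ₐ[k] B) (J.val : A ⊗[k] A)
        * ((↑y⁻¹ : B) ⊗ₜ[k] (↑y⁻¹ : B)) := by
  obtain ⟨f, hΔ, hε, hR⟩ := h.exists_algEquiv
  obtain ⟨F, hF, hFJ⟩ := Twist.exists_symm_twist J K f hΔ hε hR
  obtain ⟨x, hx⟩ := F.exists_comul_mul_eq_of_comm_eq hF
  set ff := Algebra.TensorProduct.map (f : A →ₐ[k] B) (f : A →ₐ[k] B)
  have hff : ∀ a b, ff (a ⊗ₜ b) = f a ⊗ₜ f b := fun a b => Algebra.TensorProduct.map_tmul ..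
  let FF : (B ⊗[k] B)ˣ := Units.map (ff : A ⊗[k] A →* B ⊗[k] B) F.val
  have hFF : (FF : B ⊗[k] B) = ff F.val := rfl
  have hFFi : (↑FF⁻¹ : B ⊗[k] B) = ff (↑F.val⁻¹ : A ⊗[k] A) := rfl
  have hJu : Units.map (ff : A ⊗[k] A →* B ⊗[k] B) J.val = FF * K.val := Units.ext hFJ.symm
  -- J and K differ by F, so cancelling K shows that `f` fails to respect the untwisted coproducts
  -- only by conjugation by F.
  have hf : ∀ a, Bialgebra.comulAlgHom k B (f a)
      = ↑FF⁻¹ * ff (Bialgebra.comulAlgHom k A a) * ↑FF := by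
    intro a
    have h1 := hΔ a
    rw [Twist.comulTwisted_apply, Twist.comulTwisted_apply, map_mul, map_mul, ← hFJ] at h1
    have h2 : ff (↑J.val⁻¹ : A ⊗[k] A) = ↑K.val⁻¹ * ↑FF⁻¹ := by
      rw [← Units.val_mul, ← mul_inv_rev, ← hJu]
      rfl
    rw [h2, ← mul_assoc, Units.mul_left_inj, mul_assoc, mul_assoc, Units.mul_right_inj] at h1
    rw [← h1, mul_assoc, hFF]
  have hxx : ((x : A) ⊗ₜ[k] (x : A)) * ((↑x⁻¹ : A) ⊗ₜ[k] (↑x⁻¹ : A)) = 1 := by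
    rw [Algebra.TensorProduct.tmul_mul_tmul, Units.mul_inv, Algebra.TensorProduct.one_def]
  have hxi : (↑F.val⁻¹ : A ⊗[k] A) * Bialgebra.comulAlgHom k A (↑x⁻¹ : A)
      = (↑x⁻¹ : A) ⊗ₜ[k] (↑x⁻¹ : A) := by
    refine left_inv_eq_right_inv ?_ hxx
    rw [← hx, mul_assoc, ← mul_assoc (Bialgebra.comulAlgHom k A _) (Bialgebra.comulAlgHom k A _),
      ← map_mul, Units.inv_mul, map_one, one_mul, Units.inv_mul]
  -- Since Δ(x)F = x⊗x, precomposing `f` with conjugation by x⁻¹ absorbs the conjugation by F.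
  let φ₀ : A ≃ₐ[k] B := (MulSemiringAction.toAlgEquiv k A (ConjAct.toConjAct x⁻¹)).trans f
  have hφ : ∀ a, φ₀ a = f ((↑x⁻¹ : A) * a * x) := fun a => by
    simp [φ₀, ConjAct.units_smul_def]
  have hφφ : ∀ z, Algebra.TensorProduct.map (φ₀ : A →ₐ[k] B) (φ₀ : A →ₐ[k] B) z
      = ff (((↑x⁻¹ : A) ⊗ₜ[k] (↑x⁻¹ : A)) * z * ((x : A) ⊗ₜ[k] (x : A))) := by
    intro z
    induction z with
    | zero => simp
    | add x y hx hy => simp only [map_add, mul_add, add_mul, hx, hy]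
    | tmul a b => simp [hff, hφ]
  let φ : A ≃ₐc[k] B := BialgEquiv.ofAlgEquiv φ₀
    (AlgHom.ext fun a => by
      change Coalgebra.counit (R := k) (φ₀ a) = Coalgebra.counit (R := k) a
      rw [hφ, hε, Bialgebra.counit_mul, Bialgebra.counit_mul, mul_right_comm,
        ← Bialgebra.counit_mul, Units.inv_mul, Bialgebra.counit_one, one_mul])
    (AlgHom.ext fun a => by
      change Algebra.TensorProduct.map (φ₀ : A →ₐ[k] B) (φ₀ : A →ₐ[k] B)
        (Bialgebra.comulAlgHom k A a) = Bialgebra.comulAlgHom k B (φ₀ a)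
      rw [hφφ, hφ, hf, hFF, hFFi, ← map_mul, ← map_mul, map_mul (Bialgebra.comulAlgHom k A),
        map_mul (Bialgebra.comulAlgHom k A), ← hxi, ← hx]
      simp only [mul_assoc])
  refine ⟨φ, f, Units.map (f : A →* B) x, fun a => ?_, hR, ?_⟩
  · change f a = f x * φ₀ a * f (↑x⁻¹ : A)
    rw [hφ, ← map_mul, ← map_mul]
    simp [mul_assoc]
  · change (K.val : B ⊗[k] B) = Bialgebra.comulAlgHom k B (f x)
        * Algebra.TensorProduct.map (φ₀ : A →ₐ[k] B) (φ₀ : A →ₐ[k] B) (J.val : A ⊗[k] A)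
        * (f (↑x⁻¹ : A) ⊗ₜ[k] f (↑x⁻¹ : A))
    rw [hφφ, hf, ← hff, mul_assoc _ (ff _) (ff _), ← map_mul ff, mul_assoc _ _ (_ ⊗ₜ[k] _), hxx,
      mul_one, hFF, mul_assoc, ← map_mul ff, ← mul_assoc (F.val : A ⊗[k] A), mul_assoc,
      ← map_mul ff, ← mul_assoc, ← mul_assoc, hx, hxx, one_mul, ← hFJ, ← hFF, ← mul_assoc,
      Units.inv_mul, one_mul]

/-! ### Units of subalgebras, bialgebra maps of group algebras, tensor identities -/

/-- An element of a finite-dimensional subalgebra that is invertible in the ambient algebra is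
invertible in the subalgebra. -/
theorem isUnit_of_isUnit_map {k Q A : Type*} [Field k] [Ring Q] [Algebra k Q] [Module.Finite k Q]
    [Ring A] [Algebra k A] (q : Q →ₐ[k] A) (hq : Function.Injective q) {z : Q}
    (hz : IsUnit (q z)) : IsUnit z := by
  -- Left multiplication by z is injective because q(z) is a unit, hence surjective by finite
  -- dimension.
  have hinj : Function.Injective (LinearMap.mulLeft k z) := fun a b hab => hq <| by
    have h : q (z * a) = q (z * b) := congrArg q hab
    rw [map_mul, map_mul] at h
    exact hz.mul_left_cancel h
  obtain ⟨w, hw⟩ := LinearMap.surjective_of_injective hinj 1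
  have : IsArtinianRing Q := IsArtinianRing.of_finite k Q
  exact ⟨⟨z, w, hw, mul_eq_one_comm.1 hw⟩, rfl⟩

/-- An isomorphism of group algebras as bialgebras comes from an isomorphism of groups. -/
theorem exists_mulEquiv_of_bialgEquiv {k G G' : Type*} [Field k] [Group G] [Group G']
    (φ : k[G] ≃ₐc[k] k[G']) :
    ∃ ψ : G ≃* G', ∀ g, φ (MonoidAlgebra.of k G g) = MonoidAlgebra.of k G' (ψ g) := by
  -- The group is recovered as the group-like elements, on which a bialgebra map acts functorially.
  refine ⟨MonoidHom.toMulEquiv (MonoidAlgebra.mapDomainOfBialgHom (φ : k[G] →ₐc[k] k[G']))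
    (MonoidAlgebra.mapDomainOfBialgHom (φ.symm : k[G'] →ₐc[k] k[G])) ?_ ?_, fun g => ?_⟩
  · rw [← MonoidAlgebra.mapDomainOfBialgHom_comp, ← MonoidAlgebra.mapDomainOfBialgHom_id (R := k)]
    congr 1
    exact BialgHom.ext φ.symm_apply_apply
  · rw [← MonoidAlgebra.mapDomainOfBialgHom_comp, ← MonoidAlgebra.mapDomainOfBialgHom_id (R := k)]
    congr 1
    exact BialgHom.ext φ.apply_symm_apply
  · exact (MonoidAlgebra.single_mapDomainOfBialgHom (φ : k[G] →ₐc[k] k[G']) g 1).symm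

lemma comm_map {k A B : Type*} [CommRing k] [Ring A] [Algebra k A] [Ring B] [Algebra k B]
    (f : A →ₐ[k] B) (z : A ⊗[k] A) :
    Algebra.TensorProduct.comm k B B (Algebra.TensorProduct.map f f z)
      = Algebra.TensorProduct.map f f (Algebra.TensorProduct.comm k A A z) := by
  induction z with
  | zero => simp
  | add x y hx hy => simp only [map_add, hx, hy]
  | tmul a b => simp

lemma map_map_tmul_self {k A B C : Type*} [CommRing k] [Ring A] [Algebra k A] [Ring B]
    [Algebra k B] [Ring C] [Algebra k C] (g : B →ₐ[k] C) (f : A →ₐ[k] B) (z : A ⊗[k] A) :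
    Algebra.TensorProduct.map g g (Algebra.TensorProduct.map f f z)
      = Algebra.TensorProduct.map (g.comp f) (g.comp f) z := by
  induction z with
  | zero => simp
  | add x y hx hy => simp only [map_add, hx, hy]
  | tmul a b => simp

/-- If `b f(a) = g(a) b` for all `a`, then `(b ⊗ b) (f ⊗ f)(z) = (g ⊗ g)(z) (b ⊗ b)`. -/
lemma tmul_self_mul_map {k A B : Type*} [CommRing k] [Ring A] [Algebra k A] [Ring B] [Algebra k B]
    (f g : A →ₐ[k] B) (b : B) (h : ∀ a, b * f a = g a * b) (z : A ⊗[k] A) :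
    (b ⊗ₜ[k] b) * Algebra.TensorProduct.map f f z
      = Algebra.TensorProduct.map g g z * (b ⊗ₜ[k] b) := by
  induction z with
  | zero => simp
  | add x y hx hy => simp only [map_add, mul_add, add_mul, hx, hy]
  | tmul a b => simp [h]

lemma exists_map_eq_map {k A B C : Type*} [CommRing k] [Ring A] [Algebra k A] [Ring B]
    [Algebra k B] [Ring C] [Algebra k C] (u : A →ₐ[k] C) (q : B →ₐ[k] C)
    (h : ∀ a, ∃ b, q b = u a) (z : A ⊗[k] A) :
    ∃ w : B ⊗[k] B, Algebra.TensorProduct.map q q w = Algebra.TensorProduct.map u u z := by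
  induction z with
  | zero => exact ⟨0, by simp⟩
  | add x y hx hy =>
    obtain ⟨v, hv⟩ := hx
    obtain ⟨w, hw⟩ := hy
    exact ⟨v + w, by rw [map_add, map_add, hv, hw]⟩
  | tmul a b =>
    obtain ⟨v, hv⟩ := h a
    obtain ⟨w, hw⟩ := h b
    exact ⟨v ⊗ₜ w, by simp [hv, hw]⟩

end HopfTwist

/-! ### The main theorem: moving the gauge into k[H'] -/

open HopfTwist TensorProduct in
theorem theorem3p1 {k G G' : Type*} [Field k] [IsAlgClosed k]
    [Group G] [Finite G] [Group G'] [Finite G']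
    (H : Subgroup G) (H' : Subgroup G')
    (J : HopfTwist.Twist k k[H]) (J' : HopfTwist.Twist k k[H'])
    (hJ : J.IsMinimal) (hJ' : J'.IsMinimal)
    (hiso : HopfTwist.TriangularIsomorphic k J.ofSubgroup.rMatrix J'.ofSubgroup.rMatrix) :
    ∃ (φ : G ≃* G') (hφ : H.map (φ : G →* G') = H'),
      (J.map (MonoidAlgebra.mapDomainBialgHom k
        (((φ.subgroupMap H).trans (MulEquiv.subgroupCongr hφ)) : H →* H'))).GaugeEquivalent J' := by
  obtain ⟨φ, f, y, hfφ, hR, hK⟩ := hiso.exists_gauge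
  obtain ⟨ψ, hψ⟩ := exists_mulEquiv_of_bialgEquiv φ
  let i : k[H] →ₐ[k] k[G] := MonoidAlgebra.mapDomainBialgHom k H.subtype
  let q : k[H'] →ₐ[k] k[G'] := MonoidAlgebra.mapDomainBialgHom k H'.subtype
  have hi : Function.Injective i := MonoidAlgebra.mapDomain_injective H.subtype_injective
  have hq : Function.Injective q := MonoidAlgebra.mapDomain_injective H'.subtype_injective
  have hiof : ∀ h : H, i (MonoidAlgebra.of k H h) = MonoidAlgebra.of k G h :=
    fun h => MonoidAlgebra.mapDomainBialgHom_single H.subtype h 1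
  have hqof : ∀ h : H', q (MonoidAlgebra.of k H' h) = MonoidAlgebra.of k G' h :=
    fun h => MonoidAlgebra.mapDomainBialgHom_single H'.subtype h 1
  let u : k[H] →ₐ[k] k[G'] := (f : k[G] →ₐ[k] k[G']).comp i
  let p : k[H] →ₐ[k] k[G'] := (φ : k[G] →ₐ[k] k[G']).comp i
  have hup : ∀ w, u w = y * p w * (↑y⁻¹ : k[G']) := fun w => hfφ (i w)
  have hu : Function.Injective u := f.injective.comp hi
  have hR' : Algebra.TensorProduct.map u u
        (Algebra.TensorProduct.comm k _ _ (↑J.val⁻¹ : k[H] ⊗[k] k[H]) * (J.val : k[H] ⊗[k] k[H]))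
      = Algebra.TensorProduct.map q q (Algebra.TensorProduct.comm k _ _
        (↑J'.val⁻¹ : k[H'] ⊗[k] k[H']) * (J'.val : k[H'] ⊗[k] k[H'])) := by
    have h1 : (↑J.ofSubgroup.val⁻¹ : k[G] ⊗[k] k[G])
      = Algebra.TensorProduct.map i i (↑J.val⁻¹ : k[H] ⊗[k] k[H]) := rfl
    have h2 : (↑J'.ofSubgroup.val⁻¹ : k[G'] ⊗[k] k[G'])
      = Algebra.TensorProduct.map q q (↑J'.val⁻¹ : k[H'] ⊗[k] k[H']) := rfl
    have h3 : (J.ofSubgroup.val : k[G] ⊗[k] k[G]) = Algebra.TensorProduct.map i i J.val := rfl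
    have h4 : (J'.ofSubgroup.val : k[G'] ⊗[k] k[G']) = Algebra.TensorProduct.map q q J'.val := rfl
    rw [h1, h2, h3, h4, comm_map, comm_map, ← map_mul, ← map_mul, map_map_tmul_self] at hR
    exact hR
  -- Minimality of both twists gives f(k[H]) = k[H'], one inclusion from each.
  have huq : ∀ w, ∃ v, q v = u w := fun w =>
    range_le_range_of_map_eq u.toLinearMap q.toLinearMap hu _ _ hR' hJ.1 ⟨w, rfl⟩
  have hqu : ∀ v, ∃ w, u w = q v := fun v =>
    range_le_range_of_map_eq q.toLinearMap u.toLinearMap hq _ _ hR'.symm hJ'.1 ⟨v, rfl⟩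
  have hyy : ((↑y⁻¹ : k[G']) ⊗ₜ[k] (↑y⁻¹ : k[G'])) * ((y : k[G']) ⊗ₜ[k] (y : k[G'])) = 1 := by
    rw [Algebra.TensorProduct.tmul_mul_tmul, Units.inv_mul, Algebra.TensorProduct.one_def]
  have hK' : Algebra.TensorProduct.map q q (J'.val : k[H'] ⊗[k] k[H'])
      = Bialgebra.comulAlgHom k k[G'] y * Algebra.TensorProduct.map p p (J.val : k[H] ⊗[k] k[H])
        * ((↑y⁻¹ : k[G']) ⊗ₜ[k] (↑y⁻¹ : k[G'])) := by
    have h3 : (J.ofSubgroup.val : k[G] ⊗[k] k[G]) = Algebra.TensorProduct.map i i J.val := rfl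
    rw [h3, map_map_tmul_self] at hK
    exact hK
  -- `Δ(y)` lies in `(k[H'] ⊗ k[H']) (y ⊗ y)`
  obtain ⟨T, hT⟩ := exists_map_eq_map u q huq (↑J.val⁻¹ : k[H] ⊗[k] k[H])
  have hΔy : Bialgebra.comulAlgHom k k[G'] y
      = Algebra.TensorProduct.map q q (J'.val * T) * ((y : k[G']) ⊗ₜ[k] (y : k[G'])) := by
    -- Solve the gauge relation for Δ(y), which gives J'(y⊗y)(p⊗p)(J⁻¹); pushing y⊗y to the right
    -- replaces p by u = Ad(y)∘p, whose image lies in k[H'].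
    rw [map_mul, hT, mul_assoc, ← tmul_self_mul_map p u y (fun w => by simp [hup]), hK',
      mul_assoc, ← mul_assoc (_ ⊗ₜ[k] _) (_ ⊗ₜ[k] _), hyy, one_mul, mul_assoc, ← map_mul,
      Units.mul_inv, map_one, mul_one]
  obtain ⟨a, z, haz⟩ := exists_of_eq_mul q (y : k[G']) y.ne_zero _ hΔy
  have hz : IsUnit z := by
    refine isUnit_of_isUnit_map q hq ?_
    rw [← Units.isUnit_mul_units _ y, ← haz]
    exact (Group.isUnit a).map (MonoidAlgebra.of k G')
  obtain ⟨z, rfl⟩ := hz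
  have hai : MonoidAlgebra.of k G' a⁻¹ = (↑y⁻¹ : k[G']) * q (↑z⁻¹ : k[H']) := by
    refine left_inv_eq_right_inv (a := MonoidAlgebra.of k G' a) ?_ ?_
    · rw [← map_mul, inv_mul_cancel, map_one]
    · rw [haz, mul_assoc, Units.mul_inv_cancel_left, ← map_mul, Units.mul_inv, map_one]
  -- The group element a = zy corrects ψ: on k[H], Ad(a)∘φ = Ad(z)∘f, where f(k[H]) = k[H'] and z is
  -- a unit of k[H'].
  let θ : G ≃* G' := ψ.trans (MulAut.conj a)
  let c : k[H] →ₐ[k] k[G'] := MonoidAlgebra.mapDomainBialgHom k ((θ : G →* G').comp H.subtype)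
  have hcof : ∀ h : H, c (MonoidAlgebra.of k H h) = MonoidAlgebra.of k G' (θ h) :=
    fun h => MonoidAlgebra.mapDomainBialgHom_single _ h 1
  have hca : ∀ w, c w = MonoidAlgebra.of k G' a * p w * MonoidAlgebra.of k G' a⁻¹ := by
    intro w
    induction w using MonoidAlgebra.induction_on with
    | of h =>
      change _ = _ * φ (i _) * _
      rw [hcof, hiof, hψ, ← map_mul, ← map_mul]
      rfl
    | add v w hv hw => simp only [map_add, mul_add, add_mul, hv, hw]
    | smul r w hw => simp only [map_smul, mul_smul_comm, smul_mul_assoc, hw]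
  have hcu : ∀ w, c w = q z * u w * q (↑z⁻¹ : k[H']) := by
    intro w
    rw [hca, haz, hai, hup]
    simp only [mul_assoc]
  have hθ : H.map (θ : G →* G') = H' := by
    apply le_antisymm
    · rintro _ ⟨h, hh, rfl⟩
      obtain ⟨v, hv⟩ := huq (MonoidAlgebra.of k H ⟨h, hh⟩)
      have h1 := hcu (MonoidAlgebra.of k H ⟨h, hh⟩)
      rw [← hv, hcof, ← map_mul, ← map_mul] at h1
      simpa using mem_range_of_mapDomain_eq_of H'.subtype _ _ h1.symm
    · intro h' hh'
      -- The element z⁻¹h'z is chosen so that conjugation by z returns h'; a group element in the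
      -- image of `c` must come from H.
      obtain ⟨w, hw⟩ := hqu (↑z⁻¹ * MonoidAlgebra.of k H' ⟨h', hh'⟩ * z)
      have h1 := hcu w
      rw [hw, ← map_mul, ← map_mul, mul_assoc (↑z⁻¹ : k[H']), Units.mul_inv_cancel_left,
        Units.mul_inv_cancel_right, hqof] at h1
      obtain ⟨h, hh⟩ := mem_range_of_mapDomain_eq_of _ _ _ h1
      exact ⟨h, h.2, hh⟩
  -- Since y = z⁻¹a and a is group-like, Δ(y) = Δ(z⁻¹)(a⊗a): the factors a are absorbed into θ,
  -- leaving z⁻¹ as the gauge element.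
  refine ⟨θ, hθ, z⁻¹, ?_⟩
  let m : k[H] →ₐ[k] k[H'] := MonoidAlgebra.mapDomainBialgHom k
    (((θ.subgroupMap H).trans (MulEquiv.subgroupCongr hθ)) : H →* H')
  have hqm : q.comp m = c := by
    refine MonoidAlgebra.algHom_ext (fun h => ?_) (Subsingleton.elim _ _)
    change q (m (MonoidAlgebra.of k H h)) = c (MonoidAlgebra.of k H h)
    have h1 : m (MonoidAlgebra.of k H h) = MonoidAlgebra.of k H'
        (((θ.subgroupMap H).trans (MulEquiv.subgroupCongr hθ)) h) :=
      MonoidAlgebra.mapDomainBialgHom_single _ h 1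
    rw [hcof, h1, hqof]
    rfl
  have hqq : Function.Injective (Algebra.TensorProduct.map q q) :=
    TensorProduct.map_injective_of_flat_flat q.toLinearMap q.toLinearMap hq hq
  have hqΔ : ∀ v, Algebra.TensorProduct.map q q (Bialgebra.comulAlgHom k k[H'] v)
      = Bialgebra.comulAlgHom k k[G'] (q v) :=
    CoalgHomClass.map_comp_comul_apply (MonoidAlgebra.mapDomainBialgHom k H'.subtype)
  have hΔa : Bialgebra.comulAlgHom k k[G'] (MonoidAlgebra.of k G' a)
      = MonoidAlgebra.of k G' a ⊗ₜ[k] MonoidAlgebra.of k G' a :=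
    (MonoidAlgebra.isGroupLikeElem_of a).comul_eq_tmul_self
  -- The gauge identity is checked in k[G']⊗k[G'], where y and a are available.
  apply hqq
  change _ = Algebra.TensorProduct.map q q (Bialgebra.comulAlgHom k k[H'] (↑z⁻¹ : k[H'])
    * Algebra.TensorProduct.map m m (J.val : k[H] ⊗[k] k[H]) * ((z : k[H']) ⊗ₜ[k] (z : k[H'])))
  have h1 := tmul_self_mul_map p c (MonoidAlgebra.of k G' a) (fun w => by
    rw [hca, mul_assoc _ _ (MonoidAlgebra.of k G' a), ← map_mul, inv_mul_cancel, map_one, mul_one])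
    (J.val : k[H] ⊗[k] k[H])
  have h2 : (q z ⊗ₜ[k] q z) * ((y : k[G']) ⊗ₜ[k] (y : k[G']))
      = MonoidAlgebra.of k G' a ⊗ₜ[k] MonoidAlgebra.of k G' a := by
    rw [Algebra.TensorProduct.tmul_mul_tmul, haz]
  have hyy' : ((y : k[G']) ⊗ₜ[k] (y : k[G'])) * ((↑y⁻¹ : k[G']) ⊗ₜ[k] (↑y⁻¹ : k[G'])) = 1 := by
    rw [Algebra.TensorProduct.tmul_mul_tmul, Units.mul_inv, Algebra.TensorProduct.one_def]
  have h3 : q z ⊗ₜ[k] q z = MonoidAlgebra.of k G' a ⊗ₜ[k] MonoidAlgebra.of k G' a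
      * ((↑y⁻¹ : k[G']) ⊗ₜ[k] (↑y⁻¹ : k[G'])) := by
    rw [← h2, mul_assoc, hyy', mul_one]
  rw [map_mul, map_mul, map_map_tmul_self, hqm, hqΔ, Algebra.TensorProduct.map_tmul, h3,
    mul_assoc, ← mul_assoc _ (_ ⊗ₜ[k] _) (_ ⊗ₜ[k] _), ← h1, ← hΔa, haz, map_mul, mul_assoc,
    mul_assoc, ← mul_assoc, ← map_mul, ← map_mul, Units.inv_mul, map_one, map_one, one_mul, hK',
    mul_assoc]
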